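/- Let $N\ge 1$. For a probability vector $x=(x_0,x_1,\dots,x_N)$ put $|\vec x\rangle=\sqrt{x_0}\,|0\cdots0\rangle+\sqrt{x_1}\,|10\cdots0\rangle+\cdots+\sqrt{x_N}\,|0\cdots01\rangle\in(\mathbb C^2)^{\otimes N}$, and let $|W_N\rangle$ be the case $x_0=0$, $x_1=\dots=x_N=1/N$. A unit vector $\Psi$ is a W-class state if $\Psi=(A_1\otimes\cdots\otimes A_N)|W_N\rangle$ with all $A_i\in GL_2(\mathbb C)$; $x$ is a coefficient vector of $\Psi$ if $\Psi=(U_1\otimes\cdots\otimes U_N)|\vec x\rangle$ for some unitaries $U_i$. Say that $\Psi$ can be converted to $\Phi$ with probability $p$ if there is a protocol of finitely many rounds of local measurements with classical communication (LOCC) which, run on $\Psi$, has total probability $p$ of ending in the state $\Phi$ (up to a global phase). Let $\Psi,\Phi$ be $N$-qubit W-class states with coefficient vectors $x,y$, where $y_k\neq0$ for $k=0,\dots,N$. Put $r_k=x_k/y_k$ and suppose $r_1\le r_2\le\cdots\le r_N$. 1. If $r_1\ge r_0$, then $\Psi$ can be converted to $\Phi$ with probability $\min\{1,r_1\}$. 2.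 Otherwise, let $h\in\{1,\dots,N\}$ be the largest index such that $r_0>r_h$. Then $\Psi$ can be converted to $\Phi$ with probability $$r_h\left(\frac{r_{h-1}}{r_0}\right)\cdots\left(\frac{r_1}{r_0}\right).$$ -/

import Mathlib

open scoped Matrix

namespace WClass

noncomputable section

/-- A (not necessarily normalised) vector of the `N`-qubit space `(ℂ²)^{⊗N}`, given by its
amplitudes in the computational basis. -/
abbrev State (N : ℕ) : Type := (Fin N → Fin 2) → ℂ

/-- The squared Euclidean norm of a vector. -/
def normSq {N : ℕ} (ψ : State N) : ℝ := ∑ s, ‖ψ s‖ ^ 2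

/-- The tensor product `A₁ ⊗ ⋯ ⊗ A_N` of one-qubit operators. -/
def tensorOp {N : ℕ} (A : Fin N → Matrix (Fin 2) (Fin 2) ℂ) :
    Matrix (Fin N → Fin 2) (Fin N → Fin 2) ℂ :=
  Matrix.of fun s t => ∏ i, A i (s i) (t i)

/-- The operator `I ⊗ ⋯ ⊗ A ⊗ ⋯ ⊗ I` with `A` acting on the qubit of party `k`. -/
def localOp {N : ℕ} (k : Fin N) (A : Matrix (Fin 2) (Fin 2) ℂ) :
    Matrix (Fin N → Fin 2) (Fin N → Fin 2) ℂ :=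
  tensorOp (Function.update (fun _ => 1) k A)

/-- The computational basis vector `|s₁ s₂ ⋯ s_N⟩`. -/
def ket {N : ℕ} (s : Fin N → Fin 2) : State N := Pi.single s 1

/-- `√x₀ |0⋯0⟩ + √x₁ |10⋯0⟩ + ⋯ + √x_N |0⋯01⟩`. The entry `x 0` belongs to `|0⋯0⟩`, the entry
`x k.succ` to the basis vector in which exactly the qubit `k : Fin N` is excited. -/
def coeffState {N : ℕ} (x : Fin (N + 1) → ℝ) : State N :=
  ((√(x 0) : ℝ) : ℂ) • ket (fun _ => 0) +
    ∑ k : Fin N, ((√(x k.succ) : ℝ) : ℂ) • ket (Pi.single k 1)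

/-- The `N`-party W state: `x₀ = 0` and `x_k = 1/N` for `1 ≤ k ≤ N`. -/
def wState (N : ℕ) : State N := coeffState (Fin.cons 0 fun _ => 1 / (N : ℝ))

/-- W-class states: the normalised vectors `(A₁ ⊗ ⋯ ⊗ A_N) |W_N⟩` with all `A_i` invertible. -/
def IsWClass {N : ℕ} (Ψ : State N) : Prop :=
  normSq Ψ = 1 ∧ ∃ A : Fin N → Matrix (Fin 2) (Fin 2) ℂ,
    (∀ i, IsUnit (A i)) ∧ Ψ = tensorOp A *ᵥ wState N

/-- `x = (x₀, …, x_N)` is a coefficient vector of `Ψ`: it is a probability vector and `Ψ` is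
`∑ √x_k |k⟩` up to local unitaries. -/
def IsCoeffVector {N : ℕ} (x : Fin (N + 1) → ℝ) (Ψ : State N) : Prop :=
  (∀ k, 0 ≤ x k) ∧ ∑ k, x k = 1 ∧
    ∃ U : Fin N → Matrix.unitaryGroup (Fin 2) ℂ,
      Ψ = tensorOp (fun i => (U i : Matrix (Fin 2) (Fin 2) ℂ)) *ᵥ coeffState x

/-- Finite-round LOCC protocols, as trees: either halt, or party `k` performs on its qubit a
measurement with finitely many Kraus operators `M i`, announces the outcome `i`, and the parties
continue with the protocol `next i`. Local unitaries are the measurements with one outcome. -/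
inductive Protocol (N : ℕ) : Type
  | halt : Protocol N
  | measure (k : Fin N) (n : ℕ) (M : Fin n → Matrix (Fin 2) (Fin 2) ℂ)
      (complete : ∑ i, (M i)ᴴ * M i = 1) (next : Fin n → Protocol N) : Protocol N

open Classical in
/-- The total probability of the branches whose final state is `φ` (up to a scalar), when the
protocol is run on `ψ`. The vectors carried along a branch are not renormalised, so for a
normalised initial vector the squared norm at a leaf is the probability of that branch. -/
def Protocol.successProb {N : ℕ} (φ : State N) : Protocol N → State N → ℝ
  | .halt, ψ => if ∃ c : ℂ, ψ = c • φ then normSq ψ else 0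
  | .measure k _ M _ next, ψ => ∑ i, (next i).successProb φ (localOp k (M i) *ᵥ ψ)

/-- `ψ` can be converted to `φ` by LOCC with probability `p`. -/
def ConvertsWithProb {N : ℕ} (ψ φ : State N) (p : ℝ) : Prop :=
  ∃ P : Protocol N, P.successProb φ ψ = p

/-- The ratios `r_k = x_k / y_k`. -/
def ratio {N : ℕ} (x y : Fin (N + 1) → ℝ) (k : Fin (N + 1)) : ℝ := x k / y k

end

end WClass

/-! After local unitaries it suffices to convert `coeffState x` into a multiple of `coeffState y`;
reaching `√m • coeffState y` yields probability `m`. If r₀ ≤ r₁, set m = min(1, r₁). Relative to m·y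
the weight of |0⋯0⟩ is deficient and the other weights are in excess. A two-outcome measurement
moves weight from an excited term to |0⋯0⟩ without loss (`of_transfer`). The total excess exceeds
the deficit by 1 - m, so the deficit can be filled and the rest filtered off
(`convertsWithProbGE_of_le`). If r₁ < r₀, diagonal filters suffice (`convertsWithProbGE_filter`). A
party with r_k < r₀ damps its |0⟩ amplitude, which lowers every weight except its own by r_k/r₀; the
others damp their |1⟩ amplitude. All ratios become r₀∏(r_k/r₀), the product running over r_k < r₀.
Lower bounds on the success probability compose freely, so the argument uses `ConvertsWithProbGE`;
exact values are recovered at the end by mixing with a failing protocol. -/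

namespace WClass

section

variable {N : ℕ}

/-! ### Algebra of local operators. -/

theorem normSq_nonneg (ψ : State N) : 0 ≤ normSq ψ :=
  Finset.sum_nonneg fun _ _ => by positivity

theorem normSq_zero : normSq (0 : State N) = 0 := by simp [normSq]

theorem normSq_smul (c : ℂ) (ψ : State N) : normSq (c • ψ) = ‖c‖ ^ 2 * normSq ψ := by
  simp [normSq, Finset.mul_sum, mul_pow]

theorem tensorOp_mul (A B : Fin N → Matrix (Fin 2) (Fin 2) ℂ) :
    tensorOp A * tensorOp B = tensorOp fun i => A i * B i := by
  ext s t
  simp only [tensorOp, Matrix.mul_apply, Matrix.of_apply, Finset.prod_univ_sum,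
    ← Finset.prod_mul_distrib, Fintype.piFinset_univ]

theorem tensorOp_one : tensorOp (fun _ : Fin N => (1 : Matrix (Fin 2) (Fin 2) ℂ)) = 1 := by
  ext s t
  simp only [tensorOp, Matrix.of_apply, Matrix.one_apply]
  by_cases h : s = t
  · simp [h]
  · obtain ⟨i, hi⟩ := Function.ne_iff.mp h
    rw [if_neg h]
    exact Finset.prod_eq_zero (Finset.mem_univ i) (if_neg hi)

theorem tensorOp_mulVec_ket (A : Fin N → Matrix (Fin 2) (Fin 2) ℂ) (s t : Fin N → Fin 2) :
    (tensorOp A *ᵥ ket t) s = ∏ i, A i (s i) (t i) := by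
  simp [ket, tensorOp]

theorem tensorOp_diagonal_mulVec_ket (d : Fin N → Fin 2 → ℂ) (t : Fin N → Fin 2) :
    (tensorOp fun i => Matrix.diagonal (d i)) *ᵥ ket t = (∏ i, d i (t i)) • ket t := by
  ext s
  rw [tensorOp_mulVec_ket]
  by_cases h : s = t
  · simp [h, ket]
  · obtain ⟨i, hi⟩ := Function.ne_iff.mp h
    rw [Finset.prod_eq_zero (Finset.mem_univ i)
      (show Matrix.diagonal (d i) (s i) (t i) = 0 from Matrix.diagonal_apply_ne _ hi)]
    simp [ket, h]

theorem localOp_mulVec_ket (k : Fin N) (M : Matrix (Fin 2) (Fin 2) ℂ) (t : Fin N → Fin 2) :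
    localOp k M *ᵥ ket t =
      M 0 (t k) • ket (Function.update t k 0) + M 1 (t k) • ket (Function.update t k 1) := by
  ext s
  rw [localOp, tensorOp_mulVec_ket]
  by_cases h : ∀ i, i ≠ k → s i = t i
  · obtain ⟨b, rfl⟩ : ∃ b, s = Function.update t k b := ⟨s k, by
      ext i
      by_cases hi : i = k
      · subst hi; simp
      · simp [hi, h i hi]⟩
    have hinj : ∀ b c : Fin 2, Function.update t k b = Function.update t k c ↔ b = c :=
      fun b c => (Function.update_injective t k).eq_iff
    rw [Finset.prod_eq_single k]
    · fin_cases b <;> simp [ket, hinj]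
    · intro i _ hi
      simp [hi]
    · simp
  · push Not at h
    obtain ⟨i, hik, hi⟩ := h
    have hne : ∀ b, s ≠ Function.update t k b := fun b hb => hi (by rw [hb]; simp [hik])
    rw [Finset.prod_eq_zero (Finset.mem_univ i) (by simp [hik, hi])]
    simp [ket, hne]

/-- The vector `v₀ |0⋯0⟩ + v₁ |10⋯0⟩ + ⋯ + v_N |0⋯01⟩`. -/
noncomputable def wVector (v : Fin (N + 1) → ℂ) : State N :=
  v 0 • ket (fun _ => 0) + ∑ k : Fin N, v k.succ • ket (Pi.single k 1)

theorem coeffState_eq_wVector (x : Fin (N + 1) → ℝ) :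
    coeffState x = wVector fun k => ((√(x k) : ℝ) : ℂ) := rfl

theorem smul_wVector (c : ℂ) (v : Fin (N + 1) → ℂ) :
    c • wVector v = wVector fun k => c * v k := by
  simp [wVector, smul_add, Finset.smul_sum, smul_smul]

theorem tensorOp_diagonal_mulVec_wVector (d : Fin N → Fin 2 → ℂ) (v : Fin (N + 1) → ℂ) :
    (tensorOp fun i => Matrix.diagonal (d i)) *ᵥ wVector v =
      wVector (Fin.cons ((∏ i, d i 0) * v 0)
        fun k => (d k 1 * ∏ i ∈ Finset.univ.erase k, d i 0) * v k.succ) := by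
  have h : ∀ k : Fin N, ∏ i, d i ((Pi.single k 1 : Fin N → Fin 2) i) =
      d k 1 * ∏ i ∈ Finset.univ.erase k, d i 0 := by
    intro k
    rw [← Finset.mul_prod_erase _ _ (Finset.mem_univ k), Pi.single_eq_same]
    congr 1
    refine Finset.prod_congr rfl fun i hi => ?_
    rw [Pi.single_eq_of_ne (Finset.ne_of_mem_erase hi)]
  simp only [wVector, Matrix.mulVec_add, Matrix.mulVec_sum, Matrix.mulVec_smul,
    tensorOp_diagonal_mulVec_ket, h, smul_smul, Fin.cons_zero, Fin.cons_succ]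
  congr 1
  · rw [mul_comm]
  · exact Finset.sum_congr rfl fun k _ => by rw [mul_comm]

theorem localOp_upperTriangular_mulVec_wVector (k : Fin N) (a b c : ℂ) (v : Fin (N + 1) → ℂ) :
    localOp k !![a, b; 0, c] *ᵥ wVector v =
      wVector (Fin.cons (a * v 0 + b * v k.succ)
        fun j => (if j = k then c else a) * v j.succ) := by
  have h0 : Function.update (fun _ => 0 : Fin N → Fin 2) k 0 = fun _ => 0 := by simp
  have hk : Function.update (Pi.single k 1 : Fin N → Fin 2) k 0 = fun _ => 0 := by
    ext i; by_cases hi : i = k <;> simp [hi]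
  have hk1 : Function.update (Pi.single k 1 : Fin N → Fin 2) k 1 = Pi.single k 1 := by
    ext i; by_cases hi : i = k <;> simp [hi]
  have hj : ∀ j : Fin N, j ≠ k →
      Function.update (Pi.single j 1 : Fin N → Fin 2) k 0 = Pi.single j 1 := by
    intro j hj
    rw [Function.update_eq_self_iff]
    simp [hj.symm]
  simp only [wVector, Matrix.mulVec_add, Matrix.mulVec_sum, Matrix.mulVec_smul,
    localOp_mulVec_ket, Fin.cons_zero, Fin.cons_succ]
  rw [← Finset.add_sum_erase _ _ (Finset.mem_univ k),
    ← Finset.add_sum_erase (Finset.univ : Finset (Fin N)) (fun j : Fin N =>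
      ((if j = k then c else a) * v j.succ) • (ket (Pi.single j 1) : State N)) (Finset.mem_univ k)]
  have hsum : ∀ j ∈ Finset.univ.erase k,
      v j.succ • ((!![a, b; 0, c] : Matrix (Fin 2) (Fin 2) ℂ) 0 ((Pi.single j 1 : Fin N → Fin 2) k) •
        (ket (Function.update (Pi.single j 1) k 0) : State N) +
        (!![a, b; 0, c] : Matrix (Fin 2) (Fin 2) ℂ) 1 ((Pi.single j 1 : Fin N → Fin 2) k) •
        ket (Function.update (Pi.single j 1) k 1)) =
      ((if j = k then c else a) * v j.succ) • (ket (Pi.single j 1) : State N) := by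
    intro j hjm
    have hne := Finset.ne_of_mem_erase hjm
    simp [hne, hne.symm, hj j hne, smul_smul, mul_comm]
  rw [Finset.sum_congr rfl hsum]
  simp only [h0, hk, hk1, Pi.single_eq_same, Matrix.of_apply, Matrix.cons_val', Matrix.cons_val_zero,
    Matrix.cons_val_one, Matrix.cons_val_fin_one, if_true]
  module

/-! ### Success probabilities and their lower bounds. -/

theorem Protocol.successProb_nonneg (φ : State N) (P : Protocol N) (ψ : State N) :
    0 ≤ P.successProb φ ψ := by
  induction P generalizing ψ with
  | halt =>
    rw [Protocol.successProb]
    split_ifs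
    exacts [normSq_nonneg ψ, le_rfl]
  | measure k n M hM next ih =>
    rw [Protocol.successProb]
    exact Finset.sum_nonneg fun i _ => ih i _

theorem Protocol.successProb_smul (φ : State N) (P : Protocol N) (c : ℂ) (ψ : State N) :
    P.successProb φ (c • ψ) = ‖c‖ ^ 2 * P.successProb φ ψ := by
  induction P generalizing ψ with
  | halt =>
    simp only [Protocol.successProb]
    by_cases hc : c = 0
    -- The zero vector is a multiple of every `φ`, so this case is separate; its norm makes it
    -- harmless.
    · simp [hc, normSq_zero]
    · have h : (∃ d : ℂ, c • ψ = d • φ) ↔ ∃ d : ℂ, ψ = d • φ := by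
        constructor
        · rintro ⟨d, hd⟩
          exact ⟨c⁻¹ * d, by rw [mul_smul, ← hd, inv_smul_smul₀ hc]⟩
        · rintro ⟨d, hd⟩
          exact ⟨c * d, by rw [mul_smul, ← hd]⟩
      by_cases hψ : ∃ d : ℂ, ψ = d • φ
      · rw [if_pos (h.mpr hψ), if_pos hψ, normSq_smul]
      · rw [if_neg (mt h.mp hψ), if_neg hψ, mul_zero]
  | measure k n M hM next ih =>
    simp only [Protocol.successProb, Matrix.mulVec_smul, ih, Finset.mul_sum]

/-- Some LOCC protocol converts `ψ` to `φ` with probability at least `p`. -/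
def ConvertsWithProbGE (ψ φ : State N) (p : ℝ) : Prop :=
  ∃ P : Protocol N, p ≤ P.successProb φ ψ

theorem convertsWithProbGE_smul_self (c : ℂ) (φ : State N) :
    ConvertsWithProbGE (c • φ) φ (‖c‖ ^ 2 * normSq φ) := by
  refine ⟨.halt, ?_⟩
  rw [Protocol.successProb, if_pos ⟨c, rfl⟩, normSq_smul]

theorem ConvertsWithProbGE.smul {ψ φ : State N} {p : ℝ} (h : ConvertsWithProbGE ψ φ p) (c : ℂ) :
    ConvertsWithProbGE (c • ψ) φ (‖c‖ ^ 2 * p) := by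
  obtain ⟨P, hP⟩ := h
  exact ⟨P, by rw [Protocol.successProb_smul]; gcongr⟩

theorem ConvertsWithProbGE.measure_two {ψ φ : State N} {p q : ℝ} (k : Fin N)
    {K L : Matrix (Fin 2) (Fin 2) ℂ} (hKL : Kᴴ * K + Lᴴ * L = 1)
    (hK : ConvertsWithProbGE (localOp k K *ᵥ ψ) φ p)
    (hL : ConvertsWithProbGE (localOp k L *ᵥ ψ) φ q) : ConvertsWithProbGE ψ φ (p + q) := by
  obtain ⟨P, hP⟩ := hK
  obtain ⟨Q, hQ⟩ := hL
  refine ⟨.measure k 2 ![K, L] (by simpa [Fin.sum_univ_two] using hKL) ![P, Q], ?_⟩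
  simpa [Protocol.successProb, Fin.sum_univ_two] using add_le_add hP hQ

/-! ### Kraus operators and recovery of exact probabilities. -/

/-- `K` can occur as a Kraus operator of a measurement. -/
def IsKraus (K : Matrix (Fin 2) (Fin 2) ℂ) : Prop :=
  ∃ L : Matrix (Fin 2) (Fin 2) ℂ, Kᴴ * K + Lᴴ * L = 1

theorem isKraus_of_unitary (U : Matrix.unitaryGroup (Fin 2) ℂ) :
    IsKraus (U : Matrix (Fin 2) (Fin 2) ℂ) := by
  refine ⟨0, ?_⟩
  have := Matrix.mem_unitaryGroup_iff'.mp U.2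
  rw [Matrix.star_eq_conjTranspose] at this
  simpa using this

theorem isKraus_diagonal (d : Fin 2 → ℝ) (h : ∀ i, d i ^ 2 ≤ 1) :
    IsKraus (Matrix.diagonal fun i => (d i : ℂ)) := by
  refine ⟨Matrix.diagonal fun i => ((√(1 - d i ^ 2) : ℝ) : ℂ), ?_⟩
  rw [Matrix.diagonal_conjTranspose, Matrix.diagonal_conjTranspose, Matrix.diagonal_mul_diagonal,
    Matrix.diagonal_mul_diagonal, Matrix.diagonal_add, ← Matrix.diagonal_one]
  congr 1
  ext i
  simp only [Pi.star_apply, RCLike.star_def, Complex.conj_ofReal]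
  have := Real.mul_self_sqrt (sub_nonneg.mpr (h i))
  rw [← Complex.ofReal_mul, ← Complex.ofReal_mul, ← Complex.ofReal_add, this]
  norm_num [sq]

theorem ConvertsWithProbGE.of_localOp {ψ φ : State N} {p : ℝ} (k : Fin N)
    {K : Matrix (Fin 2) (Fin 2) ℂ} (hK : IsKraus K)
    (h : ConvertsWithProbGE (localOp k K *ᵥ ψ) φ p) : ConvertsWithProbGE ψ φ p := by
  obtain ⟨L, hL⟩ := hK
  simpa using h.measure_two k hL ⟨.halt, Protocol.successProb_nonneg _ _ _⟩

/-- The parties act one after another; all branches other than the one with every `K i` are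
discarded, which only lowers the bound. -/
theorem ConvertsWithProbGE.of_tensorOp {ψ φ : State N} {p : ℝ}
    {K : Fin N → Matrix (Fin 2) (Fin 2) ℂ} (hK : ∀ i, IsKraus (K i))
    (h : ConvertsWithProbGE (tensorOp K *ᵥ ψ) φ p) : ConvertsWithProbGE ψ φ p := by
  have key : ∀ s : Finset (Fin N), ConvertsWithProbGE
      ((tensorOp fun i => if i ∈ s then K i else 1) *ᵥ ψ) φ p → ConvertsWithProbGE ψ φ p := by
    intro s
    induction s using Finset.induction_on with
    | empty =>
      intro h
      simpa [tensorOp_one] using h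
    | insert k s hk ih =>
      intro h
      refine ih (of_localOp k (hK k) ?_)
      rw [Matrix.mulVec_mulVec, localOp, tensorOp_mul]
      have hins : (fun i => Function.update (fun _ => 1) k (K k) i * if i ∈ s then K i else 1) =
          fun i => if i ∈ insert k s then K i else 1 := by
        funext i
        by_cases hi : i = k
        · subst hi; simp [hk]
        · simp [hi]
      rw [hins]
      exact h
  exact key Finset.univ (by simpa using h)

/-- Party `k` measures its qubit and resets it to a basis state `a` that differs from `s k`, where
`φ s ≠ 0`. Every leaf then has zero amplitude at `s`, so only the zero vector can be a multiple of
`φ`. -/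
theorem exists_protocol_successProb_eq_zero (k : Fin N) {φ : State N} (hφ : φ ≠ 0) :
    ∃ P : Protocol N, ∀ ψ, P.successProb φ ψ = 0 := by
  obtain ⟨s, hs⟩ := Function.ne_iff.mp hφ
  obtain ⟨a, ha⟩ := exists_ne (s k)
  refine ⟨.measure k 2 (fun b => Matrix.single a b 1) ?_ fun _ => .halt, fun ψ => ?_⟩
  · simp only [Matrix.conjTranspose_single, Matrix.single_mul_single_same, star_one, mul_one]
    ext i j
    fin_cases i <;> fin_cases j <;> simp [Fin.sum_univ_two]
  · simp only [Protocol.successProb]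
    refine Finset.sum_eq_zero fun b _ => ?_
    split_ifs with h
    · obtain ⟨c, hc⟩ := h
      have h0 : (localOp k (Matrix.single a b 1) *ᵥ ψ) s = 0 := by
        rw [Matrix.mulVec, dotProduct]
        refine Finset.sum_eq_zero fun t _ => ?_
        rw [localOp, tensorOp, Matrix.of_apply,
          Finset.prod_eq_zero (Finset.mem_univ k) (by simp [ha]), zero_mul]
      have hc0 : c = 0 := by
        have := congrFun hc s
        rw [h0, Pi.smul_apply, smul_eq_mul, eq_comm, mul_eq_zero] at this
        exact this.resolve_right hs
      rw [hc, hc0, zero_smul, normSq_zero]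
    · rfl

/-- A biased coin, realised by scalar Kraus operators, runs the good protocol with probability `p /
q` and a surely failing one otherwise. -/
theorem ConvertsWithProbGE.convertsWithProb (k : Fin N) {ψ φ : State N} {p : ℝ} (hφ : φ ≠ 0)
    (hp : 0 ≤ p) (h : ConvertsWithProbGE ψ φ p) : ConvertsWithProb ψ φ p := by
  obtain ⟨P, hP⟩ := h
  obtain ⟨Q, hQ⟩ := exists_protocol_successProb_eq_zero k hφ
  set q := P.successProb φ ψ with hq
  rcases hp.eq_or_lt with rfl | hp'
  · exact ⟨Q, hQ ψ⟩
  have hq0 : 0 < q := hp'.trans_le hP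
  have hle : p / q ≤ 1 := (div_le_one hq0).mpr hP
  have hsmul : ∀ c : ℂ, localOp k (c • 1) *ᵥ ψ = c • ψ := by
    intro c
    have : localOp k (c • 1) = c • (1 : Matrix (Fin N → Fin 2) (Fin N → Fin 2) ℂ) := by
      rw [← tensorOp_one]
      ext s t
      simp only [localOp, tensorOp, Matrix.of_apply, Matrix.smul_apply, smul_eq_mul]
      rw [← Finset.mul_prod_erase _ _ (Finset.mem_univ k),
        ← Finset.mul_prod_erase Finset.univ (fun i => (1 : Matrix (Fin 2) (Fin 2) ℂ) (s i) (t i))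
          (Finset.mem_univ k), ← mul_assoc]
      congr 1
      · simp
      · exact Finset.prod_congr rfl fun i hi => by simp [Finset.ne_of_mem_erase hi]
    rw [this, Matrix.smul_mulVec, Matrix.one_mulVec]
  refine ⟨.measure k 2 ![((√(p / q) : ℝ) : ℂ) • 1, ((√(1 - p / q) : ℝ) : ℂ) • 1] ?_ ![P, Q], ?_⟩
  · have h1 := Real.mul_self_sqrt (div_nonneg hp hq0.le)
    have h2 := Real.mul_self_sqrt (sub_nonneg.mpr hle)
    simp only [Fin.sum_univ_two, Matrix.cons_val_zero, Matrix.cons_val_one,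
      Matrix.conjTranspose_smul, Matrix.conjTranspose_one, RCLike.star_def, Complex.conj_ofReal,
      smul_mul_smul_comm, mul_one, ← add_smul]
    rw [← Complex.ofReal_mul, ← Complex.ofReal_mul, ← Complex.ofReal_add, h1, h2]
    simp
  · simp only [Protocol.successProb, Fin.sum_univ_two, Matrix.cons_val_zero, Matrix.cons_val_one,
      hsmul, hQ, add_zero, Protocol.successProb_smul, ← hq, Complex.norm_real, Real.norm_eq_abs,
      sq_abs]
    rw [Real.sq_sqrt (div_nonneg hp hq0.le), div_mul_cancel₀ _ hq0.ne']

/-! ### Deterministic transfer of weight to |0⋯0⟩. -/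

theorem ConvertsWithProbGE.of_negate_zero {φ : State N} {p : ℝ} {v : Fin (N + 1) → ℂ}
    (h : ConvertsWithProbGE (wVector v) φ p) :
    ConvertsWithProbGE (wVector (Fin.cons (-v 0) fun k => v k.succ)) φ p := by
  have hK : ∀ _ : Fin N, IsKraus (Matrix.diagonal fun i : Fin 2 => ((![1, -1] i : ℝ) : ℂ)) :=
    fun _ => isKraus_diagonal _ fun i => by fin_cases i <;> simp
  -- Applying diag(1, -1) to every qubit flips all excited amplitudes, leaving `-wVector v`, which
  -- equals the target up to a phase.
  refine of_tensorOp hK ?_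
  rw [tensorOp_diagonal_mulVec_wVector]
  have := h.smul (-1)
  rw [smul_wVector] at this
  convert this using 2
  · ext j
    refine Fin.cases ?_ (fun j => ?_) j <;> simp
  · simp

/-- Party `k` can deterministically move weight `t` from `|0⋯1⋯0⟩` to `|0⋯0⟩`. -/
theorem ConvertsWithProbGE.of_transfer {φ : State N} {p : ℝ} (k : Fin N) {x : Fin (N + 1) → ℝ}
    {t : ℝ} (hx0 : 0 ≤ x 0) (ht : 0 ≤ t) (htx : t ≤ x k.succ)
    (h : ConvertsWithProbGE (coeffState (Fin.cons (x 0 + t)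
      fun j => if j = k then x j.succ - t else x j.succ)) φ p) :
    ConvertsWithProbGE (coeffState x) φ p := by
  rcases ht.eq_or_lt with rfl | ht'
  · convert h using 2
    ext j
    refine Fin.cases ?_ (fun j => ?_) j <;> simp
  have hxk : 0 < x k.succ := ht'.trans_le htx
  set u := √(x 0) with hu
  set w := √(x 0 + t) with hw
  set z := √(x k.succ) with hz
  set c := √(1 - t / x k.succ) with hc
  have hw0 : 0 < w := Real.sqrt_pos.mpr (by linarith)
  have hz0 : 0 < z := Real.sqrt_pos.mpr hxk
  have hu0 : 0 ≤ u := Real.sqrt_nonneg _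
  have huw : u ≤ w := Real.sqrt_le_sqrt (by linarith)
  have hu2 : u ^ 2 = x 0 := Real.sq_sqrt hx0
  have hw2 : w ^ 2 = x 0 + t := Real.sq_sqrt (by linarith)
  have hz2 : z ^ 2 = x k.succ := Real.sq_sqrt hxk.le
  have htz : t / x k.succ ≤ 1 := (div_le_one hxk).mpr htx
  have hc2 : c ^ 2 = 1 - t / x k.succ := Real.sq_sqrt (by linarith)
  -- The two outcomes send the |0⋯0⟩ amplitude `u` to `w` or `-w`, up to the factors `a`, `b`. Their
  -- probabilities `a ^ 2`, `b ^ 2` give ±w the mean `u`, so the off-diagonal completeness entry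
  -- vanishes; the variance `w ^ 2 - u ^ 2 = t` gives the diagonal one.
  set a := √((w + u) / (2 * w)) with ha
  set b := √((w - u) / (2 * w)) with hb
  have ha2 : a ^ 2 = (w + u) / (2 * w) := Real.sq_sqrt (by positivity)
  have hb2 : b ^ 2 = (w - u) / (2 * w) :=
    Real.sq_sqrt (div_nonneg (by linarith) (by positivity))
  have hab : a ^ 2 + b ^ 2 = 1 := by rw [ha2, hb2]; field_simp; ring
  have hoff : a ^ 2 * ((w - u) / z) + b ^ 2 * ((-w - u) / z) = 0 := by
    rw [ha2, hb2]; field_simp; ring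
  have hdiag : a ^ 2 * (((w - u) / z) ^ 2 + c ^ 2) + b ^ 2 * (((-w - u) / z) ^ 2 + c ^ 2) = 1 := by
    have : a ^ 2 * ((w - u) / z) ^ 2 + b ^ 2 * ((-w - u) / z) ^ 2 = t / x k.succ := by
      rw [ha2, hb2, ← hz2, show t = w ^ 2 - u ^ 2 by rw [hw2, hu2]; ring]
      field_simp
      ring
    linear_combination this + c ^ 2 * hab + hc2
  have hcz : c * z = √(x k.succ - t) := by
    rw [hc, hz, ← Real.sqrt_mul (by linarith)]
    congr 1
    field_simp
  have hcoeff : coeffState (Fin.cons (x 0 + t)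
      fun j => if j = k then x j.succ - t else x j.succ) =
      wVector (Fin.cons (w : ℂ) fun j : Fin N =>
        (if j = k then (c : ℂ) else 1) * ((√(x j.succ) : ℝ) : ℂ)) := by
    rw [coeffState_eq_wVector]
    congr 1
    ext j
    refine Fin.cases ?_ (fun j => ?_) j
    · simp [hw]
    · by_cases hj : j = k
      · subst hj
        simp only [Fin.cons_succ, if_true]
        rw [← hcz]
        push_cast
        rfl
      · simp [hj]
  rw [hcoeff] at h
  have hK : ∀ e f : ℝ, localOp k !![(e : ℂ), ((e * ((f - u) / z) : ℝ) : ℂ); 0, ((e * c : ℝ) : ℂ)] *ᵥ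
      coeffState x = (e : ℂ) • wVector (Fin.cons (f : ℂ) fun j : Fin N =>
        (if j = k then (c : ℂ) else 1) * ((√(x j.succ) : ℝ) : ℂ)) := by
    intro e f
    rw [coeffState_eq_wVector, localOp_upperTriangular_mulVec_wVector, smul_wVector]
    congr 1
    ext j
    refine Fin.cases ?_ (fun j => ?_) j
    · simp only [Fin.cons_zero]
      rw [← hu, ← hz]
      norm_cast
      field_simp
      ring
    · by_cases hj : j = k
      · simp [hj, mul_assoc]
      · simp [hj]
  have hcompl : (!![(a : ℂ), ((a * ((w - u) / z) : ℝ) : ℂ); 0, ((a * c : ℝ) : ℂ)])ᴴ *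
        !![(a : ℂ), ((a * ((w - u) / z) : ℝ) : ℂ); 0, ((a * c : ℝ) : ℂ)] +
      (!![(b : ℂ), ((b * ((-w - u) / z) : ℝ) : ℂ); 0, ((b * c : ℝ) : ℂ)])ᴴ *
        !![(b : ℂ), ((b * ((-w - u) / z) : ℝ) : ℂ); 0, ((b * c : ℝ) : ℂ)] = 1 := by
    ext i j
    fin_cases i <;> fin_cases j <;>
      simp only [Matrix.add_apply, Matrix.mul_apply, Fin.sum_univ_two, Matrix.conjTranspose_apply,
        Matrix.of_apply, Matrix.cons_val', Matrix.cons_val_zero, Matrix.cons_val_one,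
        Matrix.cons_val_fin_one, Fin.zero_eta, Fin.mk_one, Fin.isValue, RCLike.star_def,
        Complex.conj_ofReal, map_zero, mul_zero, zero_mul, add_zero, Matrix.one_apply_eq,
        ne_eq, zero_ne_one, one_ne_zero, not_false_eq_true, Matrix.one_apply_ne] <;>
      norm_cast
    · linear_combination hab
    · linear_combination hoff
    · linear_combination hoff
    · linear_combination hdiag
  have hp : p = ‖(a : ℂ)‖ ^ 2 * p + ‖(b : ℂ)‖ ^ 2 * p := by
    simp only [Complex.norm_real, Real.norm_eq_abs, sq_abs]
    linear_combination (-p) * hab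
  rw [hp]
  refine measure_two k hcompl ?_ ?_
  · rw [hK a w]
    exact h.smul _
  · rw [hK b (-w)]
    refine smul ?_ _
    have := h.of_negate_zero
    simpa using this

/-- Simultaneous transfers of weight from the singly excited basis vectors to `|0⋯0⟩`. -/
theorem ConvertsWithProbGE.of_transfers {φ : State N} {p : ℝ} {x : Fin (N + 1) → ℝ}
    {t : Fin N → ℝ} (hx0 : 0 ≤ x 0) (ht : ∀ k, 0 ≤ t k) (htx : ∀ k, t k ≤ x k.succ)
    (h : ConvertsWithProbGE (coeffState (Fin.cons (x 0 + ∑ k, t k)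
      fun j => x j.succ - t j)) φ p) :
    ConvertsWithProbGE (coeffState x) φ p := by
  have key : ∀ s : Finset (Fin N), ConvertsWithProbGE (coeffState (Fin.cons (x 0 + ∑ k ∈ s, t k)
      fun j => if j ∈ s then x j.succ - t j else x j.succ)) φ p →
      ConvertsWithProbGE (coeffState x) φ p := by
    intro s
    induction s using Finset.induction_on with
    | empty =>
      intro h
      convert h using 2
      ext j
      refine Fin.cases ?_ (fun j => ?_) j <;> simp
    | insert k s hk ih =>
      intro h
      refine ih (of_transfer k (t := t k) ?_ (ht k) ?_ ?_)
      · simpa using add_nonneg hx0 (Finset.sum_nonneg fun i _ => ht i)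
      · simpa [hk] using htx k
      · convert h using 3
        · rw [Finset.sum_insert hk, Fin.cons_zero]; ring
        · ext j
          by_cases hj : j = k
          · subst hj; simp [hk]
          · simp [hj]
  exact key Finset.univ (by simpa using h)

/-! ### Filters and the two conversion protocols. -/

/-- Local filtering: every party `k` applies the Kraus operator `diag(√(a k), √(c k))`. -/
theorem ConvertsWithProbGE.of_filter {φ : State N} {p : ℝ} {x : Fin (N + 1) → ℝ}
    {a c : Fin N → ℝ} (ha0 : ∀ k, 0 ≤ a k) (ha1 : ∀ k, a k ≤ 1) (hc0 : ∀ k, 0 ≤ c k)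
    (hc1 : ∀ k, c k ≤ 1)
    (h : ConvertsWithProbGE (coeffState (Fin.cons ((∏ k, a k) * x 0)
      fun k => (c k * ∏ i ∈ Finset.univ.erase k, a i) * x k.succ)) φ p) :
    ConvertsWithProbGE (coeffState x) φ p := by
  have hK : ∀ k, IsKraus (Matrix.diagonal fun i : Fin 2 => ((![√(a k), √(c k)] i : ℝ) : ℂ)) :=
    fun k => isKraus_diagonal _ fun i => by
      fin_cases i
      · simpa [Real.sq_sqrt (ha0 k)] using ha1 k
      · simpa [Real.sq_sqrt (hc0 k)] using hc1 k
  refine of_tensorOp hK ?_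
  rw [coeffState_eq_wVector, tensorOp_diagonal_mulVec_wVector]
  convert h using 1
  rw [coeffState_eq_wVector]
  congr 1
  ext j
  have hprod : ∀ s : Finset (Fin N), √(∏ i ∈ s, a i) = ∏ i ∈ s, √(a i) := fun s => by
    simp only [Real.sqrt_eq_rpow]
    exact (Real.finsetProd_rpow s a (fun i _ => ha0 i) _).symm
  refine Fin.cases ?_ (fun j => ?_) j
  · simp only [Fin.cons_zero, Matrix.cons_val_zero]
    rw [Real.sqrt_mul (Finset.prod_nonneg fun i _ => ha0 i), hprod]
    push_cast
    rfl
  · simp only [Fin.cons_succ, Matrix.cons_val_zero, Matrix.cons_val_one, Matrix.cons_val_fin_one]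
    rw [Real.sqrt_mul (mul_nonneg (hc0 j) (Finset.prod_nonneg fun i _ => ha0 i)),
      Real.sqrt_mul (hc0 j), hprod]
    push_cast
    rfl

theorem convertsWithProbGE_of_coeffState_smul {Φ : State N} {y : Fin (N + 1) → ℝ} {m : ℝ}
    (hm : 0 ≤ m) (hΦ : normSq Φ = 1) (hy : IsCoeffVector y Φ) :
    ConvertsWithProbGE (coeffState fun k => m * y k) Φ m := by
  obtain ⟨-, -, U, hU⟩ := hy
  refine .of_tensorOp (fun i => isKraus_of_unitary (U i)) ?_
  have : coeffState (fun k => m * y k) = ((√m : ℝ) : ℂ) • coeffState y := by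
    rw [coeffState_eq_wVector, coeffState_eq_wVector, smul_wVector]
    simp only [Real.sqrt_mul hm, Complex.ofReal_mul]
  rw [this, Matrix.mulVec_smul, ← hU]
  simpa [hΦ, Real.sq_sqrt hm] using convertsWithProbGE_smul_self ((√m : ℝ) : ℂ) Φ

theorem ConvertsWithProbGE.of_isCoeffVector {Ψ Φ : State N} {x : Fin (N + 1) → ℝ} {p : ℝ}
    (hx : IsCoeffVector x Ψ) (h : ConvertsWithProbGE (coeffState x) Φ p) :
    ConvertsWithProbGE Ψ Φ p := by
  obtain ⟨-, -, U, rfl⟩ := hx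
  refine of_tensorOp (fun i => isKraus_of_unitary (U i)⁻¹) ?_
  rw [Matrix.mulVec_mulVec, tensorOp_mul]
  simp only [← Matrix.UnitaryGroup.mul_val, inv_mul_cancel, Matrix.UnitaryGroup.one_val,
    tensorOp_one, Matrix.one_mulVec]
  exact h

/-- If `x₀ ≤ m y₀` and `m y_k ≤ x_k` for the other `k`, then probability `m` is achievable. -/
theorem convertsWithProbGE_of_le {Φ : State N} {x y : Fin (N + 1) → ℝ} {m : ℝ} (hm : 0 ≤ m)
    (hm1 : m ≤ 1) (hx0 : 0 ≤ x 0) (hxs : ∑ k, x k = 1) (hΦ : normSq Φ = 1)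
    (hy : IsCoeffVector y Φ) (h0 : x 0 ≤ m * y 0) (hk : ∀ k : Fin N, m * y k.succ ≤ x k.succ) :
    ConvertsWithProbGE (coeffState x) Φ m := by
  have hyn := hy.1
  have hys := hy.2.1
  set E := ∑ k : Fin N, (x k.succ - m * y k.succ) with hE
  set D := m * y 0 - x 0 with hD
  have hD0 : 0 ≤ D := sub_nonneg.mpr h0
  -- Both vectors sum to 1, hence `E - D = 1 - m`.
  have hDE : D ≤ E := by
    rw [Fin.sum_univ_succ] at hxs hys
    rw [hE, Finset.sum_sub_distrib, ← Finset.mul_sum]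
    nlinarith
  have hl0 : 0 ≤ D / E := div_nonneg hD0 (hD0.trans hDE)
  have hl1 : D / E ≤ 1 := div_le_one_of_le₀ hDE (hD0.trans hDE)
  -- If `E = 0` then `D = 0` too, so the convention for division by zero does no harm.
  have hlE : D / E * E = D := div_mul_cancel_of_imp fun h => le_antisymm (h ▸ hDE) hD0
  have hd : ∀ k : Fin N, 0 ≤ x k.succ - m * y k.succ := fun k => sub_nonneg.mpr (hk k)
  have hmy : ∀ k : Fin N, 0 ≤ m * y k.succ := fun k => mul_nonneg hm (hyn _)
  refine .of_transfers (t := fun k => D / E * (x k.succ - m * y k.succ)) hx0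
    (fun k => mul_nonneg hl0 (hd k)) (fun k => ?_) ?_
  · nlinarith [mul_le_mul_of_nonneg_right hl1 (hd k), hmy k]
  rw [← Finset.mul_sum, ← hE, hlE]
  have hle : ∀ k : Fin N,
      m * y k.succ ≤ x k.succ - D / E * (x k.succ - m * y k.succ) := fun k => by
    nlinarith [mul_le_mul_of_nonneg_right hl1 (hd k)]
  -- The |0⋯0⟩ weight is now exactly `m * y 0`, so only the |1⟩ amplitudes are damped.
  refine .of_filter (a := fun _ => 1)
    (c := fun k => m * y k.succ / (x k.succ - D / E * (x k.succ - m * y k.succ)))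
    (fun _ => zero_le_one) (fun _ => le_rfl)
    (fun k => div_nonneg (hmy k) ((hmy k).trans (hle k)))
    (fun k => div_le_one_of_le₀ (hle k) ((hmy k).trans (hle k))) ?_
  convert convertsWithProbGE_of_coeffState_smul hm hΦ hy using 2
  ext j
  refine Fin.cases ?_ (fun j => ?_) j
  · simp [hD]
  · simp only [Fin.cons_succ, Finset.prod_const_one, mul_one]
    exact div_mul_cancel_of_imp fun h => le_antisymm (h ▸ hle j) (hmy j)

/-- Filtering equalises the ratios `r k = x k / y k`: party `k` lowers all other ratios if
`r k < r 0`, and its own ratio otherwise. -/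
theorem convertsWithProbGE_filter {Φ : State N} {x y : Fin (N + 1) → ℝ} {r : Fin (N + 1) → ℝ}
    (hΦ : normSq Φ = 1) (hy : IsCoeffVector y Φ) (hr : ∀ k, 0 ≤ r k) (hr0 : 0 < r 0)
    (hxr : ∀ k, x k = r k * y k) :
    ConvertsWithProbGE (coeffState x) Φ
      (r 0 * ∏ k : Fin N, if r k.succ < r 0 then r k.succ / r 0 else 1) := by
  have ha0 : ∀ k : Fin N, 0 ≤ if r k.succ < r 0 then r k.succ / r 0 else 1 := fun k => by
    split_ifs
    exacts [div_nonneg (hr _) hr0.le, zero_le_one]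
  refine .of_filter (a := fun k => if r k.succ < r 0 then r k.succ / r 0 else 1)
    (c := fun k => if r k.succ < r 0 then 1 else r 0 / r k.succ) ha0 (fun k => ?_) (fun k => ?_)
    (fun k => ?_) ?_
  · split_ifs with h
    exacts [div_le_one_of_le₀ h.le hr0.le, le_rfl]
  · split_ifs
    exacts [zero_le_one, div_nonneg hr0.le (hr _)]
  · split_ifs with h
    exacts [le_rfl, div_le_one_of_le₀ (not_lt.mp h) (hr _)]
  convert convertsWithProbGE_of_coeffState_smul
    (mul_nonneg hr0.le (Finset.prod_nonneg fun k _ => ha0 k)) hΦ hy using 2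
  ext j
  refine Fin.cases ?_ (fun j => ?_) j
  · simp only [Fin.cons_zero, hxr]
    ring
  · simp only [Fin.cons_succ, hxr j.succ]
    -- Splitting off party `j`'s own factor shows what its weight escapes: `r j.succ / r 0` if its
    -- ratio is small, nothing otherwise.
    rw [← Finset.mul_prod_erase _ _ (Finset.mem_univ j)]
    split_ifs with h
    · field_simp
    · have : 0 < r j.succ := hr0.trans_le (not_lt.mp h)
      field_simp

end

end WClass

/-! ### The two cases of the theorem. -/

open WClass in
theorem theorem2 {N : ℕ} (hN : 1 ≤ N) (Ψ Φ : State N) (hΨ : IsWClass Ψ) (hΦ : IsWClass Φ)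
    (x y : Fin (N + 1) → ℝ) (hx : IsCoeffVector x Ψ) (hy : IsCoeffVector y Φ)
    (hy0 : ∀ k, y k ≠ 0)
    (hr : ∀ i j : Fin (N + 1), 1 ≤ i → i ≤ j → ratio x y i ≤ ratio x y j) :
    (ratio x y 0 ≤ ratio x y 1 → ConvertsWithProb Ψ Φ (min 1 (ratio x y 1))) ∧
    (ratio x y 1 < ratio x y 0 →
      ∃ h : Fin (N + 1), IsGreatest {k : Fin (N + 1) | 1 ≤ k ∧ ratio x y k < ratio x y 0} h ∧
        ConvertsWithProb Ψ Φ
          (ratio x y h * ∏ k ∈ Finset.Ico 1 h, (ratio x y k / ratio x y 0))) := by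
  obtain ⟨n, rfl⟩ : ∃ n, N = n + 1 := ⟨N - 1, by omega⟩
  have hΦ1 := hΦ.1
  have hΦ0 : Φ ≠ 0 := by
    rintro rfl
    simp [normSq_zero] at hΦ1
  have hyp : ∀ k, 0 < y k := fun k => (hy.1 k).lt_of_ne' (hy0 k)
  have hrn : ∀ k, 0 ≤ ratio x y k := fun k => div_nonneg (hx.1 k) (hyp k).le
  have hxr : ∀ k, x k = ratio x y k * y k := fun k => (div_mul_cancel₀ _ (hy0 k)).symm
  have h1 : ∀ k : Fin (n + 1), (1 : Fin (n + 1 + 1)) ≤ k.succ := fun k => by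
    rw [← Fin.succ_zero_eq_one]
    exact Fin.succ_le_succ_iff.mpr (Fin.zero_le k)
  refine ⟨fun h => ?_, fun h => ?_⟩
  · have hm : 0 ≤ min 1 (ratio x y 1) := le_min zero_le_one (hrn 1)
    refine (ConvertsWithProbGE.of_isCoeffVector hx (convertsWithProbGE_of_le hm (min_le_left _ _)
      (hx.1 0) hx.2.1 hΦ1 hy ?_ fun k => ?_)).convertsWithProb 0 hΦ0 hm
    · rw [hxr 0]
      refine mul_le_mul_of_nonneg_right (le_min ?_ h) (hyp 0).le
      have hle : ∀ k, ratio x y 0 ≤ ratio x y k := fun k =>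
        Fin.cases le_rfl (fun k => h.trans (hr 1 _ le_rfl (h1 k))) k
      -- The smallest ratio is at most the `y`-average of all ratios, which is 1.
      calc ratio x y 0 = ∑ k, ratio x y 0 * y k := by rw [← Finset.mul_sum, hy.2.1, mul_one]
        _ ≤ ∑ k, x k := Finset.sum_le_sum fun k _ => by
          rw [hxr k]
          exact mul_le_mul_of_nonneg_right (hle k) (hyp k).le
        _ = 1 := hx.2.1
    · rw [hxr k.succ]
      exact mul_le_mul_of_nonneg_right ((min_le_right _ _).trans (hr 1 _ le_rfl (h1 k)))
        (hyp _).le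
  · have hr0 : 0 < ratio x y 0 := (hrn 1).trans_lt h
    set S := Finset.univ.filter fun k : Fin (n + 1 + 1) => 1 ≤ k ∧ ratio x y k < ratio x y 0
      with hS
    have hne : S.Nonempty := ⟨1, by simp [hS, h]⟩
    have hmax : IsGreatest {k : Fin (n + 1 + 1) | 1 ≤ k ∧ ratio x y k < ratio x y 0}
        (S.max' hne) := by
      have := S.isGreatest_max' hne
      simpa [hS] using this
    set m := S.max' hne with hmdef
    refine ⟨m, hmax, ?_⟩
    -- Monotonicity of the ratios makes the damping parties an initial segment.
    have hSm : S = Finset.Icc 1 m := by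
      ext k
      simp only [hS, Finset.mem_filter, Finset.mem_univ, true_and, Finset.mem_Icc]
      exact ⟨fun hk => ⟨hk.1, hmax.2 hk⟩, fun hk => ⟨hk.1, (hr k m hk.1 hk.2).trans_lt hmax.1.2⟩⟩
    have hprod : ratio x y 0 * ∏ k : Fin (n + 1),
        (if ratio x y k.succ < ratio x y 0 then ratio x y k.succ / ratio x y 0 else 1) =
        ratio x y m * ∏ k ∈ Finset.Ico 1 m, (ratio x y k / ratio x y 0) := by
      have e : ∏ k : Fin (n + 1),
          (if ratio x y k.succ < ratio x y 0 then ratio x y k.succ / ratio x y 0 else 1) =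
          ∏ k ∈ S, (ratio x y k / ratio x y 0) := by
        rw [hS, Finset.prod_filter,
          Fin.prod_univ_succ (n := n + 1) fun k => if 1 ≤ k ∧ ratio x y k < ratio x y 0 then _ else _]
        simp only [h1, true_and, lt_irrefl, and_false, if_false, one_mul]
      -- The leading `r 0` cancels the denominator of the factor at `m`.
      rw [e, hSm, ← Finset.Ico_insert_right hmax.1.1, Finset.prod_insert (by simp)]
      field_simp
    rw [← hprod]
    refine (ConvertsWithProbGE.of_isCoeffVector hx (convertsWithProbGE_filter hΦ1 hy hrn hr0
      hxr)).convertsWithProb 0 hΦ0 ?_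
    rw [hprod]
    exact mul_nonneg (hrn _) (Finset.prod_nonneg fun k _ => div_nonneg (hrn _) (hrn _))
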